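/- For a space $X$ with basepoint $x$, let $\Omega(X,x)$ be the space of loops at $x$ with the compact-open topology, and let $\pi_1^{qtop}(X,x)$ be the fundamental group $\pi_1(X,x)$ with the quotient topology along $\Omega(X,x)\to\pi_1(X,x)$. For a group $G$ equipped with a topology (no continuity of the operations required), let $F_M(G)$ be the free (Markov) topological group on the space $G$, and let $\tau(G)$ be the group $G$ with the quotient topology along the homomorphism $F_M(G)\to G$ that restricts to the identity on generators; $\tau(G)$ is a topological group. Put $\pi_1^{\tau}(X,x)=\tau(\pi_1^{qtop}(X,x))$. Let $Z$ be an arbitrary topological space with basepoint $z_0$, let $n\ge 2$ be an integer, let $e\in S^{n-1}$ be a basepoint, and let $f_\alpha:S^{n-1}\to Z$, $\alpha\in A$, be an arbitrary family of continuous maps with $f_\alpha(e)=z_0$. Let $Z'=Z\sqcup_{f_\alpha}e^n_\alpha$ be the space obtained from $Z$ by attaching $n$-cells along the maps $f_\alpha$, that is, the quotient space of the disjoint union $Z\sqcup\bigsqcup_{\alpha\in A}e^n_\alpha$, where each $e^n_\alpha$ is a copy of the closed unit ball of $\mathbb{R}^n$ and each boundary point $s\in S^{n-1}=\partial e^n_\alpha$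 is identified with $f_\alpha(s)$. Let $j:Z\hookrightarrow Z'$ be the inclusion. Then the induced homomorphism $j_*:\pi_1^{qtop}(Z,z_0)\to\pi_1^{qtop}(Z',j(z_0))$ is a topological quotient map, and the induced homomorphism $j_*:\pi_1^{\tau}(Z,z_0)\to\pi_1^{\tau}(Z',j(z_0))$ is a quotient map of topological groups. -/

import Mathlib

/-! ### Free topological groups and the reflection `τ` -/

/-- The free (Markov) topological group on a space `Y`: the free group on the set `Y`. -/
def FreeTopGroup (Y : Type*) : Type _ := FreeGroup Y

namespace FreeTopGroup

instance (Y : Type*) : Group (FreeTopGroup Y) := inferInstanceAs (Group (FreeGroup Y))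

/-- The canonical injection of generators. -/
def of {Y : Type*} (y : Y) : FreeTopGroup Y := FreeGroup.of y

/-- The homomorphism `F(Y) → G` that extends a map `Y → G`. -/
def lift {Y G : Type*} [Group G] (f : Y → G) : FreeTopGroup Y →* G := FreeGroup.lift f

/-- The topology of the free topological group: the finest group topology on the free group for
which the injection of generators is continuous. -/
instance (Y : Type*) [TopologicalSpace Y] : TopologicalSpace (FreeTopGroup Y) :=
  (GroupTopology.coinduced (of : Y → FreeTopGroup Y)).toTopologicalSpace

instance (Y : Type*) [TopologicalSpace Y] : IsTopologicalGroup (FreeTopGroup Y) :=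
  (GroupTopology.coinduced (of : Y → FreeTopGroup Y)).toIsTopologicalGroup

theorem continuous_of {Y : Type*} [TopologicalSpace Y] :
    Continuous (of : Y → FreeTopGroup Y) :=
  GroupTopology.coinduced_continuous _

theorem lift_of {Y G : Type*} [Group G] (f : Y → G) (y : Y) : lift f (of y) = f y :=
  FreeGroup.lift_apply_of

/-- The universal property of the free topological group. -/
theorem existsUnique_lift {Y G : Type*} [TopologicalSpace Y] [Group G] [TopologicalSpace G]
    [IsTopologicalGroup G] {f : Y → G} (hf : Continuous f) :
    ∃! φ : FreeTopGroup Y →* G, Continuous φ ∧ ∀ y, φ (of y) = f y := by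
  refine ⟨lift f, ⟨?_, lift_of f⟩, fun ψ hψ => FreeGroup.ext_hom (M := G) ψ (lift f) fun y => ?_⟩
  · let g : GroupTopology (FreeTopGroup Y) :=
      { toTopologicalSpace := TopologicalSpace.induced (lift f) inferInstance
        toIsTopologicalGroup := topologicalGroup_induced (lift f) }
    have hg : GroupTopology.coinduced (of : Y → FreeTopGroup Y) ≤ g := by
      refine sInf_le ?_
      refine continuous_iff_coinduced_le.1 (continuous_induced_rng.2 ?_)
      have : (lift f : FreeTopGroup Y → G) ∘ of = f := funext (lift_of f)
      rw [this]
      exact hf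
    exact continuous_iff_le_induced.2 hg
  · exact (hψ.2 y).trans (lift_of f y).symm

end FreeTopGroup

/-- For a group with topology `G` (no compatibility assumed), the group `τ(G)`: the same group,
with the quotient topology along the multiplication epimorphism `F_M(G) → G`. -/
def Tau (G : Type*) : Type _ := G

namespace Tau

instance (G : Type*) [Group G] : Group (Tau G) := inferInstanceAs (Group G)

/-- The multiplication epimorphism `F(G) → G`, the identity on generators. -/
def mulHom (G : Type*) [Group G] : FreeTopGroup G →* Tau G :=
  FreeTopGroup.lift (fun g : G => (show Tau G from g))

theorem mulHom_surjective (G : Type*) [Group G] : Function.Surjective (mulHom G) :=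
  fun g => ⟨FreeTopGroup.of (show G from g), FreeTopGroup.lift_of _ _⟩

instance (G : Type*) [Group G] [TopologicalSpace G] : TopologicalSpace (Tau G) :=
  TopologicalSpace.coinduced (mulHom G) inferInstance

theorem isQuotientMap_mulHom (G : Type*) [Group G] [TopologicalSpace G] :
    Topology.IsQuotientMap (mulHom G) :=
  ⟨⟨rfl⟩, mulHom_surjective G⟩

instance (G : Type*) [Group G] [TopologicalSpace G] : IsTopologicalGroup (Tau G) := by
  have hq : IsOpenQuotientMap (mulHom G) :=
    MonoidHom.isOpenQuotientMap_of_isQuotientMap (isQuotientMap_mulHom G)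
  refine { continuous_mul := ?_, continuous_inv := ?_ }
  · rw [← (hq.prodMap hq).continuous_comp_iff]
    have h : Continuous fun p : FreeTopGroup G × FreeTopGroup G => mulHom G (p.1 * p.2) :=
      hq.continuous.comp continuous_mul
    simpa only [map_mul, Function.comp_def, Prod.map] using h
  · rw [← hq.continuous_comp_iff]
    have h : Continuous fun p : FreeTopGroup G => mulHom G p⁻¹ :=
      hq.continuous.comp continuous_inv
    simpa only [map_inv, Function.comp_def] using h

/-- `τ` is the identity on homomorphisms. -/
def map {G H : Type*} [Group G] [Group H] (φ : G →* H) : Tau G →* Tau H := φ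

end Tau

/-! ### Topologies on the fundamental group -/

/-- The quasitopological fundamental group `π₁^qtop(X, x)`: the fundamental group with the
quotient topology from the loop space `Ω(X, x)` (compact-open topology). -/
def PiOneQTop (X : Type*) [TopologicalSpace X] (x : X) : Type _ := FundamentalGroup X x

namespace PiOneQTop

noncomputable instance (X : Type*) [TopologicalSpace X] (x : X) : Group (PiOneQTop X x) :=
  inferInstanceAs (Group (FundamentalGroup X x))

/-- The class of a loop. -/
def mk {X : Type*} [TopologicalSpace X] {x : X} (γ : Path x x) : PiOneQTop X x :=
  FundamentalGroup.fromPath (Path.Homotopic.Quotient.mk γ)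

instance (X : Type*) [TopologicalSpace X] (x : X) : TopologicalSpace (PiOneQTop X x) :=
  TopologicalSpace.coinduced (mk : Path x x → PiOneQTop X x) inferInstance

/-- The homomorphism induced by a continuous map. -/
noncomputable def map {X Y : Type*} [TopologicalSpace X] [TopologicalSpace Y] (f : C(X, Y))
    (x : X) : PiOneQTop X x →* PiOneQTop Y (f x) :=
  FundamentalGroup.map f x

theorem map_mk {X Y : Type*} [TopologicalSpace X] [TopologicalSpace Y] (f : C(X, Y))
    {x : X} (γ : Path x x) : map f x (mk γ) = mk (γ.map f.continuous) :=
  rfl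

end PiOneQTop

/-- The topological fundamental group `π₁^τ(X, x) = τ(π₁^qtop(X, x))`. -/
abbrev PiOneTau (X : Type*) [TopologicalSpace X] (x : X) : Type _ := Tau (PiOneQTop X x)

/-- The homomorphism `π₁^τ(X, x) → π₁^τ(Y, f x)` induced by a continuous map `f`. -/
noncomputable def PiOneTau.map {X Y : Type*} [TopologicalSpace X] [TopologicalSpace Y]
    (f : C(X, Y)) (x : X) : PiOneTau X x →* PiOneTau Y (f x) :=
  Tau.map (PiOneQTop.map f x)

/-! ### Attaching cells -/

/-- The sphere `S^{n-1}`, the unit sphere of `ℝⁿ`. -/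
abbrev CellBoundary (n : ℕ) : Type := Metric.sphere (0 : EuclideanSpace ℝ (Fin n)) 1

/-- The closed `n`-cell `eⁿ`, the closed unit ball of `ℝⁿ`. -/
abbrev ClosedCell (n : ℕ) : Type := Metric.closedBall (0 : EuclideanSpace ℝ (Fin n)) 1

/-- The inclusion of the boundary sphere in the closed cell. -/
def CellBoundary.toCell {n : ℕ} (s : CellBoundary n) : ClosedCell n :=
  ⟨s.1, Metric.sphere_subset_closedBall s.2⟩

/-- The gluing relation on `Z ⊔ ⨆ₐ eⁿₐ`: a boundary point `s` of the cell with index `a` is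
identified with `f a s`. -/
inductive AttachRel {Z : Type*} [TopologicalSpace Z] {n : ℕ} {A : Type*}
    (f : A → C(CellBoundary n, Z)) :
    (Z ⊕ (Σ _ : A, ClosedCell n)) → (Z ⊕ (Σ _ : A, ClosedCell n)) → Prop
  | glue (a : A) (s : CellBoundary n) : AttachRel f (Sum.inr ⟨a, s.toCell⟩) (Sum.inl (f a s))

/-- The space obtained from `Z` by attaching one `n`-cell along each `f a : S^{n-1} → Z`: the
quotient space of the topological disjoint union `Z ⊔ ⨆ₐ eⁿₐ` by the equivalence relation
generated by `AttachRel f`. -/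
def AttachedSpace {Z : Type*} [TopologicalSpace Z] {n : ℕ} {A : Type*}
    (f : A → C(CellBoundary n, Z)) : Type _ :=
  Quot (AttachRel f)

namespace AttachedSpace

instance {Z : Type*} [TopologicalSpace Z] {n : ℕ} {A : Type*} (f : A → C(CellBoundary n, Z)) :
    TopologicalSpace (AttachedSpace f) :=
  inferInstanceAs (TopologicalSpace (Quot (AttachRel f)))

/-- The inclusion of `Z` in the space with the cells attached. -/
def incl {Z : Type*} [TopologicalSpace Z] {n : ℕ} {A : Type*} (f : A → C(CellBoundary n, Z)) :
    C(Z, AttachedSpace f) where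
  toFun z := Quot.mk (AttachRel f) (Sum.inl z)
  continuous_toFun := continuous_quot_mk.comp continuous_inl

end AttachedSpace

open Topology Filter Set
open scoped unitInterval

/-! ### `τ` preserves quotient homomorphisms -/

/-! Both quotient claims reduce to a local lifting property
(`AttachedSpace.exists_continuousAt_lift`): for each loop `γ` in `Z'` there is a map `Ψ` from loops
in `Z'` to loops in `Z`, continuous at `γ`, such that `Ψ δ` is homotopic in `Z'` to `δ` for all `δ`
near `γ`. This gives surjectivity. It also shows that a set of classes with open preimage in `π₁(Z)`
is open, since openness is checked at one loop at a time.

`Ψ` is built in two stages. First `γ` is pushed off the centres of the cells: finitely many of its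
segments, each inside one open cell, are replaced by paths avoiding the centre, which exist because
`ℝⁿ` minus a point is path connected for `n ≥ 2` (`Path.exists_locallyDeforms_mem`). Each
replacement is a time-dependent translation in the cell, so the same formula moves all nearby loops.
Then the complement of the centres is retracted radially to `Z`; it is open, so nearby loops stay in
it.

The statement for `π₁^τ` is formal: `τ` preserves quotient homomorphisms (`Tau.isQuotientMap_map`).
-/

/-- A quotient homomorphism out of a topological group is open, so its square is again a quotient
map and the operations descend. -/
theorem isTopologicalGroup_coinduced {G H : Type*} [Group G] [TopologicalSpace G]
    [IsTopologicalGroup G] [Group H] (φ : G →* H) (hφ : Function.Surjective φ) :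
    @IsTopologicalGroup H (TopologicalSpace.coinduced φ inferInstance) _ := by
  let _ : TopologicalSpace H := TopologicalSpace.coinduced φ inferInstance
  have hq : IsOpenQuotientMap φ :=
    MonoidHom.isOpenQuotientMap_of_isQuotientMap ⟨⟨rfl⟩, hφ⟩
  refine { continuous_mul := ?_, continuous_inv := ?_ }
  · rw [← (hq.prodMap hq).continuous_comp_iff]
    have h : Continuous fun p : G × G => φ (p.1 * p.2) := hq.continuous.comp continuous_mul
    simpa only [map_mul, Function.comp_def, Prod.map] using h
  · rw [← hq.continuous_comp_iff]
    have h : Continuous fun p : G => φ p⁻¹ := hq.continuous.comp continuous_inv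
    simpa only [map_inv, Function.comp_def] using h

namespace Tau

/-- The identity `G → τ(G)`. -/
def of {G : Type*} [Group G] : G →* Tau G := MonoidHom.id G

theorem continuous_of {G : Type*} [Group G] [TopologicalSpace G] :
    Continuous (of : G → Tau G) := by
  have h : (of : G → Tau G) = mulHom G ∘ FreeTopGroup.of :=
    funext fun g => (FreeTopGroup.lift_of (G := Tau G) (fun g : G => (show Tau G from g)) g).symm
  rw [h]
  exact (isQuotientMap_mulHom G).continuous.comp FreeTopGroup.continuous_of

/-- The universal property of `τ`: a homomorphism from `τ(G)` to a topological group is continuous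
as soon as it is continuous on `G`. -/
theorem continuous_hom {G K : Type*} [Group G] [TopologicalSpace G] [Group K] [TopologicalSpace K]
    [IsTopologicalGroup K] (φ : Tau G →* K) (hφ : Continuous (φ ∘ (of : G → Tau G))) :
    Continuous φ := by
  rw [(isQuotientMap_mulHom G).continuous_iff]
  obtain ⟨ψ, ⟨hψ, hψ'⟩, -⟩ := FreeTopGroup.existsUnique_lift hφ
  have h : ψ = φ.comp (mulHom G) := FreeGroup.ext_hom (M := K) _ _ fun g =>
    (hψ' g).trans (congrArg φ
      (FreeTopGroup.lift_of (G := Tau G) (fun g : G => (show Tau G from g)) g).symm)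
  rw [h] at hψ
  exact hψ

/-- The topology coinduced from `τ(G)` is a group topology for which `H → τ(H)` is continuous,
because `φ` is a quotient map. By the universal property of `τ(H)` it is therefore no finer than the
given one. -/
theorem isQuotientMap_map {G H : Type*} [Group G] [TopologicalSpace G] [Group H]
    [TopologicalSpace H] (φ : G →* H) (hφ : IsQuotientMap φ) : IsQuotientMap (map φ) := by
  have hc : Continuous (map φ) :=
    continuous_hom (map φ) ((continuous_of (G := H)).comp hφ.continuous)
  have hs : Function.Surjective (map φ) := hφ.surjective
  refine ⟨⟨le_antisymm ?_ hc.coinduced_le⟩, hs⟩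
  let t₀ : TopologicalSpace (Tau H) := inferInstance
  let t : TopologicalSpace (Tau H) := TopologicalSpace.coinduced (map φ) inferInstance
  have ht : @IsTopologicalGroup (Tau H) t _ := isTopologicalGroup_coinduced (map φ) hs
  have hid : @Continuous (Tau H) (Tau H) t₀ t id := by
    refine @continuous_hom H (Tau H) _ _ _ t ht (MonoidHom.id _) ?_
    refine hφ.continuous_iff.2 ?_
    have h : @Continuous G (Tau H) _ t (map φ ∘ of) :=
      continuous_coinduced_rng.comp (continuous_of (G := G))
    exact h
  exact continuous_id_iff_le.1 hid

end Tau

/-! ### Continuous convergence of paths -/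

/-- Continuous convergence implies compact-open convergence: a compact set is covered by finitely
many of the neighbourhoods supplied by the hypothesis. No local compactness is needed. -/
theorem ContinuousMap.tendsto_of_forall_tendsto_uncurry {ι X Y : Type*} [TopologicalSpace X]
    [TopologicalSpace Y] {l : Filter ι} {F : ι → C(X, Y)} {f : C(X, Y)}
    (h : ∀ x, Tendsto (fun p : ι × X => F p.1 p.2) (l ×ˢ 𝓝 x) (𝓝 (f x))) :
    Tendsto F l (𝓝 f) := by
  rw [ContinuousMap.tendsto_nhds_compactOpen]
  intro K hK U hU hf
  refine hK.induction_on (p := fun S => ∀ᶠ i in l, MapsTo (F i) S U) ?_ ?_ ?_ ?_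
  · exact .of_forall fun i => mapsTo_empty _ _
  · exact fun s t hst ht => ht.mono fun i hi => hi.mono_left hst
  · exact fun s t hs ht => (hs.and ht).mono fun i hi => hi.1.union hi.2
  · intro x hx
    obtain ⟨p, hp, q, hq, hpq⟩ :=
      eventually_prod_iff.1 ((h x).eventually (hU.mem_nhds (hf hx)))
    exact ⟨{y | q y}, mem_nhdsWithin_of_mem_nhds hq, hp.mono fun i hi y hy => hpq hi hy⟩

namespace Path

variable {X Y : Type*} [TopologicalSpace X] [TopologicalSpace Y]

theorem tendsto_of_forall_tendsto_uncurry {ι : Type*} {x y : X} {l : Filter ι} {F : ι → Path x y}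
    {γ : Path x y}
    (h : ∀ t, Tendsto (fun p : ι × I => F p.1 p.2) (l ×ˢ 𝓝 t) (𝓝 (γ t))) :
    Tendsto F l (𝓝 γ) := by
  rw [nhds_induced, tendsto_comap_iff]
  exact ContinuousMap.tendsto_of_forall_tendsto_uncurry h

theorem continuous_eval {x y : X} : Continuous fun p : Path x y × I => p.1 p.2 := by
  fun_prop

theorem eventually_mapsTo {x y : X} {γ : Path x y} {K : Set I} (hK : IsCompact K) {U : Set X}
    (hU : IsOpen U) (h : MapsTo γ K U) : ∀ᶠ δ : Path x y in 𝓝 γ, MapsTo δ K U :=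
  (continuous_induced_dom (f := fun γ : Path x y => (γ : C(I, X)))).continuousAt.eventually
    (ContinuousMap.eventually_mapsTo hK hU h)

/-- Near `γ`, loops can be deformed continuously to loops near `γ'`. -/
def LocallyDeforms {x y : X} (γ γ' : Path x y) : Prop :=
  ∃ Φ : Path x y → Path x y, ContinuousAt Φ γ ∧ Φ γ = γ' ∧ ∀ᶠ δ in 𝓝 γ, (Φ δ).Homotopic δ

theorem LocallyDeforms.refl {x y : X} (γ : Path x y) : LocallyDeforms γ γ :=
  ⟨id, continuousAt_id, rfl, .of_forall fun δ => .refl δ⟩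

theorem LocallyDeforms.trans {x y : X} {γ γ' γ'' : Path x y} (h : LocallyDeforms γ γ')
    (h' : LocallyDeforms γ' γ'') : LocallyDeforms γ γ'' := by
  obtain ⟨Φ, hΦ, rfl, hh⟩ := h
  obtain ⟨Φ', hΦ', rfl, hh'⟩ := h'
  refine ⟨Φ' ∘ Φ, hΦ'.comp hΦ, rfl, ?_⟩
  filter_upwards [hh, hΦ.eventually hh'] with δ h1 h2 using h2.trans h1

/-- A pointwise deformation `Θ` of a loop `γ`, where `good` loops are those along which `Θ` is
continuous. -/
theorem exists_continuousAt_of_continuousAt {x : X} {y : Y} (γ : Path x x) (Θ : I → X → Y)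
    (h0 : Θ 0 x = y) (h1 : Θ 1 x = y)
    (hc : ∀ᶠ δ : Path x x in 𝓝 γ, ∀ t, ContinuousAt (Function.uncurry Θ) (t, δ t)) :
    ∃ Φ : Path x x → Path y y, ContinuousAt Φ γ ∧ ∀ᶠ δ in 𝓝 γ, ∀ t, Φ δ t = Θ t (δ t) := by
  classical
  let good (δ : Path x x) : Prop := ∀ t, ContinuousAt (Function.uncurry Θ) (t, δ t)
  have hcont (δ : Path x x) (h : good δ) : Continuous fun t => Θ t (δ t) := by
    refine continuous_iff_continuousAt.2 fun t => ?_
    exact ContinuousAt.comp (f := fun t => (t, δ t)) (h t)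
      (continuous_id.prodMk δ.continuous).continuousAt
  -- The constant path is a default value; good loops form a neighbourhood of `γ`, so it does not
  -- affect continuity at `γ`.
  let Φ (δ : Path x x) : Path y y :=
    if h : good δ then
      { toFun := fun t => Θ t (δ t)
        continuous_toFun := hcont δ h
        source' := by simpa using h0
        target' := by simpa using h1 }
    else Path.refl y
  have hΦ (δ : Path x x) (h : good δ) (t : I) : Φ δ t = Θ t (δ t) := by
    simp only [Φ, dif_pos h]
    rfl
  have hγ : good γ := hc.self_of_nhds
  refine ⟨Φ, tendsto_of_forall_tendsto_uncurry fun t => ?_, hc.mono fun δ h => hΦ δ h⟩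
  rw [hΦ γ hγ]
  have hlim : Tendsto (fun p : Path x x × I => Θ p.2 (p.1 p.2)) (𝓝 γ ×ˢ 𝓝 t)
      (𝓝 (Θ t (γ t))) := by
    rw [← nhds_prod_eq]
    exact ContinuousAt.comp (x := (γ, t)) (f := fun p : Path x x × I => (p.2, p.1 p.2)) (hγ t)
      (continuous_snd.prodMk continuous_eval).continuousAt
  refine hlim.congr' ?_
  filter_upwards [hc.prod_inl (𝓝 t)] with p hp using (hΦ p.1 hp p.2).symm

end Path

/-! ### Pushing loops inside a chart -/

section Push

variable {X E : Type*} [NormedAddCommGroup E]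

open Classical in
/-- Translation by `v` in the chart `ψ` on `O` with inverse `φ`; the identity outside `O`. -/
noncomputable def chartPush (O : Set X) (φ : E → X) (ψ : X → E) (v : E) (p : X) : X :=
  if p ∈ O then φ (ψ p + v) else p

variable {O : Set X} {φ : E → X} {ψ : X → E}

theorem chartPush_zero (hφψ : ∀ p ∈ O, φ (ψ p) = p) (p : X) : chartPush O φ ψ 0 p = p := by
  unfold chartPush
  split_ifs with h
  · rw [add_zero, hφψ p h]
  · rfl

theorem chartPush_of_mem {p : X} (hp : p ∈ O) (v : E) : chartPush O φ ψ v p = φ (ψ p + v) :=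
  if_pos hp

theorem chartPush_of_notMem {p : X} (hp : p ∉ O) (v : E) : chartPush O φ ψ v p = p :=
  if_neg hp

variable [TopologicalSpace X]

/-- A push may be discontinuous at the frontier of `O`. The second alternative covers points outside
`O`: where the translation vanishes for all nearby parameters, the push is locally the projection.
-/
theorem continuousAt_chartPush {T : Type*} [TopologicalSpace T] (hO : IsOpen O)
    (hφ : Continuous φ) (hψ : ContinuousOn ψ O) (hφψ : ∀ p ∈ O, φ (ψ p) = p) {c : T → E}
    (hc : Continuous c) {t : T} {p : X} (h : p ∈ O ∨ c =ᶠ[𝓝 t] 0) :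
    ContinuousAt (fun q : T × X => chartPush O φ ψ (c q.1) q.2) (t, p) := by
  rcases h with h | h
  · have hO' : ∀ᶠ q : T × X in 𝓝 (t, p), q.2 ∈ O :=
      continuous_snd.continuousAt.eventually (hO.mem_nhds h)
    have h1 : ContinuousAt (fun q : T × X => φ (ψ q.2 + c q.1)) (t, p) := by
      refine hφ.continuousAt.comp (ContinuousAt.add ?_ (hc.comp continuous_fst).continuousAt)
      exact ContinuousAt.comp (f := Prod.snd) (hψ.continuousAt (hO.mem_nhds h))
        continuous_snd.continuousAt
    exact h1.congr (hO'.mono fun q hq => (chartPush_of_mem hq _).symm)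
  · have h0 : ∀ᶠ q : T × X in 𝓝 (t, p), c q.1 = 0 :=
      (continuous_fst.tendsto (t, p)).eventually h
    refine continuous_snd.continuousAt.congr (h0.mono fun q hq => ?_)
    dsimp only
    rw [hq, chartPush_zero hφψ]

variable [NormedSpace ℝ E]

/-- The displacement `c` depends on time only, so one formula deforms every loop near `γ`: such a
loop is in `O` during the compact set `C`, and off `C` nothing moves. Scaling `c` from `0` to `1`
gives the homotopy. -/
theorem Path.exists_locallyDeforms_chartPush (hO : IsOpen O)
    (hφ : Continuous φ) (hψ : ContinuousOn ψ O) (hφψ : ∀ p ∈ O, φ (ψ p) = p) {x : X} (hx : x ∉ O)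
    (γ : Path x x) {C : Set I} (hC : IsClosed C) (hγ : MapsTo γ C O) {c : I → E}
    (hc : Continuous c) (hcC : ∀ t ∉ C, c t = 0) :
    ∃ γ' : Path x x, LocallyDeforms γ γ' ∧ ∀ t, γ' t = chartPush O φ ψ (c t) (γ t) := by
  have hc0 {t : I} (ht : t ∉ C) : c =ᶠ[𝓝 t] 0 := by
    filter_upwards [hC.isOpen_compl.mem_nhds ht] with u hu using hcC u hu
  have hgood : ∀ᶠ δ : Path x x in 𝓝 γ, MapsTo δ C O := eventually_mapsTo hC.isCompact hO hγ
  obtain ⟨Φ, hΦ, hΦ'⟩ := exists_continuousAt_of_continuousAt γ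
    (fun t p => chartPush O φ ψ (c t) p) (chartPush_of_notMem hx _) (chartPush_of_notMem hx _)
    (hgood.mono fun δ hδ t => continuousAt_chartPush hO hφ hψ hφψ hc
      (by by_cases ht : t ∈ C; exacts [.inl (hδ ht), .inr (hc0 ht)]))
  refine ⟨Φ γ, ⟨Φ, hΦ, rfl, ?_⟩, hΦ'.self_of_nhds⟩
  filter_upwards [hgood, hΦ'] with δ hδ hδ'
  refine Path.Homotopic.symm ⟨{
    toFun := fun q => chartPush O φ ψ ((q.1 : ℝ) • c q.2) (δ q.2)
    continuous_toFun := ?_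
    map_zero_left := fun t => ?_
    map_one_left := fun t => ?_
    prop' := ?_ }⟩
  · refine continuous_iff_continuousAt.2 fun q => ?_
    have hcq : Continuous fun q : I × I => (q.1 : ℝ) • c q.2 := by fun_prop
    refine ContinuousAt.comp (f := fun q : I × I => (q, δ q.2))
      (continuousAt_chartPush hO hφ hψ hφψ hcq ?_)
      (continuous_id.prodMk (δ.continuous.comp continuous_snd)).continuousAt
    by_cases hq : q.2 ∈ C
    · exact .inl (hδ hq)
    · refine .inr ?_
      filter_upwards [continuous_snd.continuousAt.eventually (hc0 hq)] with q' hq'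
      simp [hq']
  · simp [chartPush_zero hφψ]
  · simp [hδ' t]
  · rintro u t (rfl | rfl) <;> simp [chartPush_of_notMem hx]

/-- A segment of a loop inside a chart may be replaced by any other path in the model space. -/
theorem Path.exists_locallyDeforms_of_joinedIn (hO : IsOpen O)
    (hφ : Continuous φ) (hψ : ContinuousOn ψ O) (hφψ : ∀ p ∈ O, φ (ψ p) = p) {x : X} (hx : x ∉ O)
    (γ : Path x x) {s t : I} (hst : s ≤ t) (hγ : MapsTo γ (Icc s t) O) {V : Set E}
    (hV : JoinedIn V (ψ (γ s)) (ψ (γ t))) :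
    ∃ γ' : Path x x, LocallyDeforms γ γ' ∧ (∀ u ∉ Ioo s t, γ' u = γ u) ∧
      ∀ u ∈ Icc s t, γ' u ∈ φ '' V := by
  obtain ⟨g, hg⟩ := hV
  -- The displacement from `γ` in the chart to `g` run linearly over `[s, t]`. It vanishes at both
  -- ends, so constant extension makes it zero outside; for `s = t` the quotient is `0 / 0 = 0`, and
  -- it still vanishes.
  let k (w : Icc s t) : E :=
    g.extend (((w : I) - s : ℝ) / (t - s)) - ψ (γ w)
  have hk : Continuous k := by
    refine Continuous.sub (g.continuous_extend.comp (by fun_prop)) ?_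
    exact hψ.comp_continuous (γ.continuous.comp continuous_subtype_val) fun w => hγ w.2
  let c : I → E := Set.IccExtend hst k
  have hc : Continuous c := hk.Icc_extend'
  have hc0 (u : I) (hu : u ∉ Ioo s t) : c u = 0 := by
    rcases le_or_gt u s with h | h
    · simp [c, k, IccExtend_of_le_left hst k h]
    · have htu : t ≤ u := not_lt.1 fun h' => hu ⟨h, h'⟩
      rcases hst.eq_or_lt with rfl | hlt
      · have : c u = k ⟨s, right_mem_Icc.2 hst⟩ := IccExtend_of_right_le hst k htu
        simp [this, k]
      · have : (t - s : ℝ) ≠ 0 := sub_ne_zero.2 fun h => hlt.ne' (Subtype.ext h)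
        simp [c, k, IccExtend_of_right_le hst k htu, div_self this]
  obtain ⟨γ', hd, hγ'⟩ := exists_locallyDeforms_chartPush hO hφ hψ hφψ hx γ isClosed_Icc hγ hc
    fun u hu => hc0 u fun h => hu (Ioo_subset_Icc_self h)
  refine ⟨γ', hd, fun u hu => ?_, fun u hu => ?_⟩
  · rw [hγ', hc0 u hu, chartPush_zero hφψ]
  · rw [hγ', chartPush_of_mem (hγ hu)]
    refine ⟨_, ?_, rfl⟩
    simp only [c, IccExtend_of_mem hst k hu, k, add_sub_cancel]
    obtain ⟨w, hw⟩ : g.extend ((u - s : ℝ) / (t - s)) ∈ range g := by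
      rw [← g.extend_range]; exact mem_range_self _
    rw [← hw]
    exact hg w

end Push

/-- If a space is covered by an open set `N` and disjoint charts `O a`, such that points of
`N ∩ O a` are joined in `N` through the chart, then a loop at a point outside the charts deforms
into `N`. -/
theorem Path.exists_locallyDeforms_mem {X E A : Type*} [TopologicalSpace X]
    [NormedAddCommGroup E] [NormedSpace ℝ E] {N : Set X} (hN : IsOpen N) {O : A → Set X}
    (hO : ∀ a, IsOpen (O a)) (hcover : ∀ p, p ∈ N ∨ ∃ a, p ∈ O a)
    (hdisj : ∀ a b p, p ∈ O a → p ∈ O b → a = b) {φ : A → E → X} {ψ : A → X → E}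
    (hφ : ∀ a, Continuous (φ a)) (hψ : ∀ a, ContinuousOn (ψ a) (O a))
    (hφψ : ∀ a, ∀ p ∈ O a, φ a (ψ a p) = p) {V : Set E} (hV : IsPathConnected V)
    (hVN : ∀ a, φ a '' V ⊆ N) (hNV : ∀ a, ∀ p ∈ O a, p ∈ N → ψ a p ∈ V)
    {x : X} (hx : ∀ a, x ∉ O a) (γ : Path x x) :
    ∃ γ' : Path x x, LocallyDeforms γ γ' ∧ ∀ t, γ' t ∈ N := by
  -- Lebesgue subdivision: each piece runs inside `N` (index `none`) or inside one chart (index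
  -- `some a`).
  obtain ⟨τ, hτ0, hτ, ⟨m, hm⟩, hcov⟩ := exists_monotone_Icc_subset_open_cover_unitInterval
    (c := fun o : Option A => γ ⁻¹' (o.elim N O))
    (fun o => by cases o; exacts [hN.preimage γ.continuous, (hO _).preimage γ.continuous])
    (fun t _ => by
      rcases hcover (γ t) with h | ⟨a, h⟩
      exacts [mem_iUnion.2 ⟨none, h⟩, mem_iUnion.2 ⟨some a, h⟩])
  have hxN : x ∈ N := (hcover x).resolve_right fun ⟨a, h⟩ => hx a h
  -- Part of the loop before `r` lies in `N`, or `r` ends a segment inside one chart.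
  let Clear (r : I) : Prop := ∃ γ' : Path x x, LocallyDeforms γ γ' ∧ (∀ u, r ≤ u → γ' u = γ u) ∧
    ∀ u ≤ r, γ' u ∈ N
  let Pending (r : I) : Prop := ∃ γ' : Path x x, LocallyDeforms γ γ' ∧
    (∀ u, r ≤ u → γ' u = γ u) ∧ ∃ a, ∃ s ≤ r, (∀ u ≤ s, γ' u ∈ N) ∧ MapsTo γ' (Icc s r) (O a)
  have clear_of_pending (r : I) (hr : γ r ∈ N) (h : Pending r) : Clear r := by
    obtain ⟨γ', hd, heq, a, s, hs, hsN, hsO⟩ := h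
    have hrN : γ' r ∈ N := by rwa [heq r le_rfl]
    obtain ⟨γ'', hd', heq', hV'⟩ := exists_locallyDeforms_of_joinedIn (hO a) (hφ a) (hψ a) (hφψ a)
      (hx a) γ' hs hsO (hV.joinedIn _ (hNV a _ (hsO (left_mem_Icc.2 hs)) (hsN s le_rfl)) _
        (hNV a _ (hsO (right_mem_Icc.2 hs)) hrN))
    refine ⟨γ'', hd.trans hd', fun u hu => ?_, fun u hu => ?_⟩
    · rw [heq' u fun h => h.2.not_ge hu, heq u hu]
    · rcases le_or_gt u s with h | h
      · rw [heq' u fun h' => h'.1.not_ge h]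
        exact hsN u h
      · exact hVN a (hV' u ⟨h.le, hu⟩)
  -- A subdivision point may lie outside `N`, so a chart segment is replaced only once its right end
  -- is in `N`. A piece in `N` provides such an end; a further chart piece lies in the same chart by
  -- disjointness and prolongs the segment.
  have key (k : ℕ) : Clear (τ k) ∨ Pending (τ k) := by
    induction k with
    | zero =>
      refine .inl ⟨γ, .refl γ, fun _ _ => rfl, fun u hu => ?_⟩
      have : u = 0 := le_antisymm (hτ0 ▸ hu) bot_le
      rwa [this, γ.source]
    | succ k ih =>
      have hle : τ k ≤ τ (k + 1) := hτ k.le_succ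
      obtain ⟨_ | a, ha⟩ := hcov k
      · have : Clear (τ k) := ih.elim id (clear_of_pending _ (ha (left_mem_Icc.2 hle)))
        obtain ⟨γ', hd, heq, hcl⟩ := this
        refine .inl ⟨γ', hd, fun u hu => heq u (hle.trans hu), fun u hu => ?_⟩
        rcases le_or_gt u (τ k) with h | h
        · exact hcl u h
        · rw [heq u h.le]
          exact ha ⟨h.le, hu⟩
      · refine .inr ?_
        rcases ih with ⟨γ', hd, heq, hcl⟩ | ⟨γ', hd, heq, b, s, hs, hcl, hsO⟩
        · refine ⟨γ', hd, fun u hu => heq u (hle.trans hu), a, τ k, hle, hcl, fun u hu => ?_⟩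
          rw [heq u hu.1]
          exact ha hu
        · have hab : b = a := hdisj b a (γ (τ k))
            (by rw [← heq _ le_rfl]; exact hsO (right_mem_Icc.2 hs)) (ha (left_mem_Icc.2 hle))
          subst hab
          refine ⟨γ', hd, fun u hu => heq u (hle.trans hu), b, s, hs.trans hle, hcl,
            fun u hu => ?_⟩
          rcases le_or_gt u (τ k) with h | h
          · exact hsO ⟨hu.1, h⟩
          · rw [heq u h.le]
            exact ha ⟨h.le, hu.2⟩
  have hfin : Clear 1 := by
    rw [← hm m le_rfl]
    exact (key m).elim id (clear_of_pending _ (by rwa [hm m le_rfl, γ.target]))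
  obtain ⟨γ', hd, -, hcl⟩ := hfin
  exact ⟨γ', hd, fun t => hcl t le_top⟩

/-! ### The geometry of a space with cells attached -/

section Radial

variable {n : ℕ}

/-- The retraction of `ℝⁿ` onto the closed unit ball. -/
noncomputable def clampCell (v : EuclideanSpace ℝ (Fin n)) : ClosedCell n :=
  ⟨(max 1 ‖v‖)⁻¹ • v, by
    rw [mem_closedBall_zero_iff, norm_smul, norm_inv, Real.norm_of_nonneg (by positivity),
      inv_mul_le_iff₀ (by positivity), mul_one]
    exact le_max_right _ _⟩

theorem continuous_clampCell : Continuous (clampCell (n := n)) := by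
  have h : Continuous fun v : EuclideanSpace ℝ (Fin n) => max 1 ‖v‖ := by fun_prop
  exact Continuous.subtype_mk ((h.inv₀ fun v => by positivity).smul continuous_id) _

theorem clampCell_coe (v : ClosedCell n) : clampCell (v : EuclideanSpace ℝ (Fin n)) = v := by
  have h : ‖(v : EuclideanSpace ℝ (Fin n))‖ ≤ 1 := mem_closedBall_zero_iff.1 v.2
  exact Subtype.ext (by simp [clampCell, max_eq_left h])

theorem clampCell_ne_zero {v : EuclideanSpace ℝ (Fin n)} (hv : v ≠ 0) :
    (clampCell v : EuclideanSpace ℝ (Fin n)) ≠ 0 := by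
  have : max 1 ‖v‖ ≠ 0 := by positivity
  exact smul_ne_zero (inv_ne_zero this) hv

open Classical in
/-- The radial projection of a cell to its boundary, sending the centre to `e`. -/
noncomputable def radialProj (e : CellBoundary n) (v : ClosedCell n) : CellBoundary n :=
  if h : (v : EuclideanSpace ℝ (Fin n)) = 0 then e
  else ⟨‖(v : EuclideanSpace ℝ (Fin n))‖⁻¹ • (v : EuclideanSpace ℝ (Fin n)), by
    rw [mem_sphere_zero_iff_norm, norm_smul, norm_inv, norm_norm,
      inv_mul_cancel₀ (norm_ne_zero_iff.2 h)]⟩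

theorem radialProj_toCell (e s : CellBoundary n) : radialProj e s.toCell = s := by
  have h1 : ‖(s : EuclideanSpace ℝ (Fin n))‖ = 1 := mem_sphere_zero_iff_norm.1 s.2
  have h0 : (s : EuclideanSpace ℝ (Fin n)) ≠ 0 := norm_ne_zero_iff.1 (by rw [h1]; exact one_ne_zero)
  refine Subtype.ext ?_
  simp [radialProj, CellBoundary.toCell, h0, h1]

theorem continuousOn_radialProj (e : CellBoundary n) :
    ContinuousOn (radialProj e) {v | (v : EuclideanSpace ℝ (Fin n)) ≠ 0} := by
  rw [IsInducing.subtypeVal.continuousOn_iff]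
  have h : ContinuousOn (fun v : ClosedCell n =>
      ‖(v : EuclideanSpace ℝ (Fin n))‖⁻¹ • (v : EuclideanSpace ℝ (Fin n)))
      {v | (v : EuclideanSpace ℝ (Fin n)) ≠ 0} :=
    ContinuousOn.smul (ContinuousOn.inv₀ (by fun_prop) fun v hv => norm_ne_zero_iff.2 hv)
      (by fun_prop)
  refine h.congr fun v hv => ?_
  simp only [mem_ofPred_eq] at hv
  simp [radialProj, hv]

/-- The segment from a point `v` of the cell to its radial projection. -/
noncomputable def radialSegment (e : CellBoundary n) (v : ClosedCell n) (u : I) : ClosedCell n :=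
  ⟨(1 - u : ℝ) • (v : EuclideanSpace ℝ (Fin n)) +
      (u : ℝ) • (radialProj e v : EuclideanSpace ℝ (Fin n)),
    convex_closedBall 0 1 v.2 (radialProj e v).toCell.2 (sub_nonneg.2 u.2.2) u.2.1 (by ring)⟩

theorem radialSegment_zero (e : CellBoundary n) (v : ClosedCell n) : radialSegment e v 0 = v :=
  Subtype.ext (by simp [radialSegment])

theorem radialSegment_one (e : CellBoundary n) (v : ClosedCell n) :
    radialSegment e v 1 = (radialProj e v).toCell :=
  Subtype.ext (by simp [radialSegment, CellBoundary.toCell])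

theorem radialSegment_toCell (e s : CellBoundary n) (u : I) :
    radialSegment e s.toCell u = s.toCell := by
  refine Subtype.ext ?_
  simp only [radialSegment, radialProj_toCell]
  change (1 - u : ℝ) • (s : EuclideanSpace ℝ (Fin n)) + (u : ℝ) • (s : EuclideanSpace ℝ (Fin n)) = s
  rw [← add_smul, sub_add_cancel, one_smul]

theorem continuous_radialSegment (e : CellBoundary n) (v : ClosedCell n) :
    Continuous (radialSegment e v) :=
  Continuous.subtype_mk (by fun_prop) _

theorem continuousOn_radialSegment (e : CellBoundary n) :
    ContinuousOn (Function.uncurry (radialSegment e))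
      ({v : ClosedCell n | (v : EuclideanSpace ℝ (Fin n)) ≠ 0} ×ˢ univ) := by
  rw [IsInducing.subtypeVal.continuousOn_iff]
  have h : ContinuousOn (fun q : ClosedCell n × I =>
      (radialProj e q.1 : EuclideanSpace ℝ (Fin n)))
      ({v : ClosedCell n | (v : EuclideanSpace ℝ (Fin n)) ≠ 0} ×ˢ univ) :=
    continuous_subtype_val.comp_continuousOn
      ((continuousOn_radialProj e).comp continuousOn_fst fun q hq => hq.1)
  refine ContinuousOn.add (Continuous.continuousOn (by fun_prop)) (ContinuousOn.fun_smul ?_ h)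
  exact Continuous.continuousOn (by fun_prop)

end Radial

namespace AttachedSpace

variable {Z : Type*} [TopologicalSpace Z] {n : ℕ} {A : Type*} (f : A → C(CellBoundary n, Z))

/-- The characteristic map of the cell with index `a`. -/
def cell (a : A) (v : ClosedCell n) : AttachedSpace f := Quot.mk _ (Sum.inr ⟨a, v⟩)

theorem continuous_cell (a : A) : Continuous (cell f a) :=
  continuous_quot_mk.comp (continuous_inr.comp continuous_sigmaMk)

theorem cell_toCell (a : A) (s : CellBoundary n) : cell f a s.toCell = incl f (f a s) :=
  Quot.sound (.glue a s)

variable {f} in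
theorem exists_rep (p : AttachedSpace f) : (∃ z, p = incl f z) ∨ ∃ a v, p = cell f a v := by
  induction p using Quot.ind with
  | mk x =>
    rcases x with z | ⟨a, v⟩
    exacts [.inl ⟨z, rfl⟩, .inr ⟨a, v, rfl⟩]

/-- The map out of `AttachedSpace f` given by compatible maps of `Z` and of the cells. -/
def desc {Y : Type*} (g : Z → Y) (h : A → ClosedCell n → Y)
    (hgh : ∀ a s, h a s.toCell = g (f a s)) : AttachedSpace f → Y :=
  Quot.lift (Sum.elim g fun c => h c.1 c.2) (by rintro _ _ ⟨a, s⟩; exact hgh a s)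

section Desc

variable {Y : Type*} {g : Z → Y} {h : A → ClosedCell n → Y}
  {hgh : ∀ a s, h a s.toCell = g (f a s)}

@[simp] theorem desc_incl (z : Z) : desc f g h hgh (incl f z) = g z := rfl

@[simp] theorem desc_cell (a : A) (v : ClosedCell n) : desc f g h hgh (cell f a v) = h a v := rfl

theorem isOpen_iff {f : A → C(CellBoundary n, Z)} {U : Set (AttachedSpace f)} :
    IsOpen U ↔ IsOpen (incl f ⁻¹' U) ∧ ∀ a, IsOpen (cell f a ⁻¹' U) := by
  have hq : IsQuotientMap (Y := AttachedSpace f) (Quot.mk (AttachRel f)) :=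
    isQuotientMap_quot_mk
  rw [← hq.isOpen_preimage, isOpen_sum_iff, isOpen_sigma_iff]
  rfl

theorem continuous_desc [TopologicalSpace Y] (hg : Continuous g) (hh : ∀ a, Continuous (h a)) :
    Continuous (desc f g h hgh) :=
  continuous_quot_lift _ (continuous_sum_dom.2 ⟨hg, continuous_sigma hh⟩)

/-- As `N` is open, continuity on it is openness of sets in the whole quotient, which can be tested
on `Z` and on each cell. -/
theorem continuousOn_desc [TopologicalSpace Y] {N : Set (AttachedSpace f)} (hN : IsOpen N)
    (hg : Continuous g) (hh : ∀ a, ContinuousOn (h a) (cell f a ⁻¹' N)) :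
    ContinuousOn (desc f g h hgh) N := by
  rw [continuousOn_open_iff hN]
  intro U hU
  rw [isOpen_iff] at hN ⊢
  exact ⟨hN.1.inter (hU.preimage hg), fun a => (hh a).isOpen_inter_preimage (hN.2 a) hU⟩

end Desc

/-- The distance to the centre of a cell, extended by `1`. -/
noncomputable def radius : AttachedSpace f → ℝ :=
  desc f (fun _ => 1) (fun _ v => ‖(v : EuclideanSpace ℝ (Fin n))‖)
    fun _ s => mem_sphere_zero_iff_norm.1 s.2

theorem continuous_radius : Continuous (radius f) :=
  continuous_desc f continuous_const fun _ => by fun_prop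

/-- The complement of the centres of the cells. -/
def punctured : Set (AttachedSpace f) := {p | radius f p ≠ 0}

theorem isOpen_punctured : IsOpen (punctured f) :=
  isOpen_ne_fun (continuous_radius f) continuous_const

theorem incl_mem_punctured (z : Z) : incl f z ∈ punctured f :=
  one_ne_zero

theorem cell_mem_punctured {a : A} {v : ClosedCell n} :
    cell f a v ∈ punctured f ↔ (v : EuclideanSpace ℝ (Fin n)) ≠ 0 :=
  norm_ne_zero_iff

open Classical in
/-- The function `1 - ‖v‖` on the cell with index `a`, extended by `0`. -/
noncomputable def depth (a : A) : AttachedSpace f → ℝ :=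
  desc f (fun _ => 0) (fun b v => if b = a then 1 - ‖(v : EuclideanSpace ℝ (Fin n))‖ else 0)
    fun _ s => by
      have : ‖(s.toCell : EuclideanSpace ℝ (Fin n))‖ = 1 := mem_sphere_zero_iff_norm.1 s.2
      simp [this]

theorem continuous_depth (a : A) : Continuous (depth f a) :=
  continuous_desc f continuous_const fun b => by
    by_cases h : b = a
    · simp only [h, if_true]; fun_prop
    · simp only [h, if_false]; fun_prop

/-- The open cell with index `a`. -/
def openCell (a : A) : Set (AttachedSpace f) := {p | 0 < depth f a p}

theorem isOpen_openCell (a : A) : IsOpen (openCell f a) :=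
  isOpen_lt continuous_const (continuous_depth f a)

theorem incl_notMem_openCell (a : A) (z : Z) : incl f z ∉ openCell f a :=
  lt_irrefl (0 : ℝ)

theorem cell_mem_openCell {a b : A} {v : ClosedCell n} :
    cell f b v ∈ openCell f a ↔ b = a ∧ ‖(v : EuclideanSpace ℝ (Fin n))‖ < 1 := by
  by_cases h : b = a <;> simp [openCell, depth, h]

open Classical in
/-- The function `(1 - ‖v‖) • v` on the cell with index `a`, extended by `0`. -/
noncomputable def scaledCoord (a : A) : AttachedSpace f → EuclideanSpace ℝ (Fin n) :=
  desc f (fun _ => 0) (fun b v => if b = a then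
      (1 - ‖(v : EuclideanSpace ℝ (Fin n))‖) • (v : EuclideanSpace ℝ (Fin n)) else 0)
    fun _ s => by
      have : ‖(s.toCell : EuclideanSpace ℝ (Fin n))‖ = 1 := mem_sphere_zero_iff_norm.1 s.2
      simp [this]

theorem continuous_scaledCoord (a : A) : Continuous (scaledCoord f a) :=
  continuous_desc f continuous_const fun b => by
    by_cases h : b = a
    · simp only [h, if_true]; fun_prop
    · simp only [h, if_false]; fun_prop

/-- The coordinate of the open cell with index `a`. -/
noncomputable def coord (a : A) (p : AttachedSpace f) : EuclideanSpace ℝ (Fin n) :=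
  (depth f a p)⁻¹ • scaledCoord f a p

/-- Numerator and denominator both vanish on the cell boundary and so are continuous on the whole
space; no separate study of the topology of an open cell is needed. -/
theorem continuousOn_coord (a : A) : ContinuousOn (coord f a) (openCell f a) :=
  ((continuous_depth f a).continuousOn.inv₀ fun _ hp => ne_of_gt hp).smul
    (continuous_scaledCoord f a).continuousOn

theorem coord_cell (a : A) {v : ClosedCell n} (hv : ‖(v : EuclideanSpace ℝ (Fin n))‖ < 1) :
    coord f a (cell f a v) = v := by
  simp [coord, depth, scaledCoord, smul_smul, inv_mul_cancel₀ (sub_pos.2 hv).ne']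

variable {f} in
theorem exists_of_mem_openCell {a : A} {p : AttachedSpace f} (hp : p ∈ openCell f a) :
    ∃ v : ClosedCell n, p = cell f a v ∧ ‖(v : EuclideanSpace ℝ (Fin n))‖ < 1 := by
  rcases exists_rep p with ⟨z, rfl⟩ | ⟨b, v, rfl⟩
  · exact absurd hp (incl_notMem_openCell f a z)
  · obtain ⟨rfl, hv⟩ := (cell_mem_openCell f).1 hp
    exact ⟨v, rfl, hv⟩

/-- The retraction of the punctured space to `Z`. -/
noncomputable def retract (e : CellBoundary n) : AttachedSpace f → Z :=
  desc f id (fun a v => f a (radialProj e v)) fun a s => by rw [radialProj_toCell]; rfl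

theorem continuousOn_retract (e : CellBoundary n) :
    ContinuousOn (retract f e) (punctured f) :=
  continuousOn_desc f (isOpen_punctured f) continuous_id fun a =>
    (f a).continuous.comp_continuousOn
      ((continuousOn_radialProj e).mono fun _ hv => (cell_mem_punctured f).1 hv)

/-- The tracks of the radial deformation of the punctured space to `Z`. -/
noncomputable def track (e : CellBoundary n) : AttachedSpace f → C(I, AttachedSpace f) :=
  desc f (fun z => .const I (incl f z))
    (fun a v => ⟨fun u => cell f a (radialSegment e v u),
      (continuous_cell f a).comp (continuous_radialSegment e v)⟩)
    fun a s => by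
      ext u
      simp [radialSegment_toCell, cell_toCell]

/-- Taking values in `C(I, ·)` lets continuity be tested on `Z` and the cells, without asking
whether the product of the quotient map with `I` is a quotient map. -/
theorem continuousOn_track (e : CellBoundary n) :
    ContinuousOn (track f e) (punctured f) :=
  continuousOn_desc f (isOpen_punctured f)
    (ContinuousMap.continuous_const'.comp (incl f).continuous) fun a => by
    refine ContinuousMap.continuousOn_of_continuousOn_uncurry _ ?_
    exact (continuous_cell f a).comp_continuousOn ((continuousOn_radialSegment e).mono
      fun q hq => ⟨(cell_mem_punctured f).1 hq.1, trivial⟩)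

theorem track_zero (e : CellBoundary n) (p : AttachedSpace f) : track f e p 0 = p := by
  rcases exists_rep p with ⟨z, rfl⟩ | ⟨a, v, rfl⟩
  · rfl
  · exact congrArg (cell f a) (radialSegment_zero e v)

theorem track_one (e : CellBoundary n) (p : AttachedSpace f) :
    track f e p 1 = incl f (retract f e p) := by
  rcases exists_rep p with ⟨z, rfl⟩ | ⟨a, v, rfl⟩
  · rfl
  · exact (congrArg (cell f a) (radialSegment_one e v)).trans (cell_toCell f a _)

theorem homotopic_map_retract (e : CellBoundary n) {z₀ : Z}
    {δ : Path (incl f z₀) (incl f z₀)} (hδ : ∀ t, δ t ∈ punctured f) {β : Path z₀ z₀}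
    (hβ : ∀ t, β t = retract f e (δ t)) :
    δ.Homotopic (β.map (incl f).continuous) := by
  refine ⟨{
    toFun := fun q => track f e (δ q.2) q.1
    continuous_toFun := ?_
    map_zero_left := fun t => track_zero f e _
    map_one_left := fun t => ?_
    prop' := ?_ }⟩
  · have h : Continuous fun t => track f e (δ t) :=
      (continuousOn_track f e).comp_continuous δ.continuous hδ
    exact (h.comp continuous_snd).eval continuous_fst
  · simp [track_one, hβ]
  · rintro u t (rfl | rfl) <;> simp [track]

/-- Here the charts are the open cells and `V` is `ℝⁿ` minus the origin, path connected by `hn`. The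
inverse charts are precomposed with `clampCell` because a translated point may leave the ball;
clamping never yields the centre from a nonzero vector. -/
theorem exists_locallyDeforms_punctured (hn : 2 ≤ n) {z₀ : Z}
    (γ : Path (incl f z₀) (incl f z₀)) :
    ∃ γ' : Path (incl f z₀) (incl f z₀), Path.LocallyDeforms γ γ' ∧ ∀ t, γ' t ∈ punctured f := by
  refine Path.exists_locallyDeforms_mem (isOpen_punctured f) (isOpen_openCell f) (fun p => ?_)
    (fun a b p ha hb => ?_) (fun a => (continuous_cell f a).comp continuous_clampCell)
    (continuousOn_coord f) (fun a p hp => ?_)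
    (isPathConnected_compl_singleton_of_one_lt_rank ?_ 0) (fun a => ?_) (fun a p hp hpN => ?_)
    (fun a => incl_notMem_openCell f a z₀) γ
  · rcases exists_rep p with ⟨z, rfl⟩ | ⟨a, v, rfl⟩
    · exact .inl (incl_mem_punctured f z)
    · by_cases hv : (v : EuclideanSpace ℝ (Fin n)) = 0
      · exact .inr ⟨a, (cell_mem_openCell f).2 ⟨rfl, by simp [hv]⟩⟩
      · exact .inl ((cell_mem_punctured f).2 hv)
  · obtain ⟨v, rfl, hv⟩ := exists_of_mem_openCell ha
    exact ((cell_mem_openCell f).1 hb).1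
  · obtain ⟨v, rfl, hv⟩ := exists_of_mem_openCell hp
    simp [coord_cell f a hv, clampCell_coe]
  · rw [← Module.finrank_eq_rank, finrank_euclideanSpace_fin]
    exact_mod_cast hn
  · rintro _ ⟨v, hv, rfl⟩
    exact (cell_mem_punctured f).2 (clampCell_ne_zero hv)
  · obtain ⟨v, rfl, hv⟩ := exists_of_mem_openCell hp
    rw [coord_cell f a hv]
    exact (cell_mem_punctured f).1 hpN

/-- Near each loop, loops in the space with cells attached are homotopic to loops in `Z` that
depend continuously on them. -/
theorem exists_continuousAt_lift (hn : 2 ≤ n) (e : CellBoundary n) {z₀ : Z}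
    (γ : Path (incl f z₀) (incl f z₀)) :
    ∃ Ψ : Path (incl f z₀) (incl f z₀) → Path z₀ z₀, ContinuousAt Ψ γ ∧
      ∀ᶠ δ in 𝓝 γ, ((Ψ δ).map (incl f).continuous).Homotopic δ := by
  obtain ⟨_, ⟨Φ, hΦ, rfl, hΦh⟩, hγ'⟩ := exists_locallyDeforms_punctured f hn γ
  -- Avoiding the centres is an open condition on loops since `I` is compact, so the retraction is
  -- continuous along all loops near `Φ γ`.
  have hN : ∀ᶠ δ : Path (incl f z₀) (incl f z₀) in 𝓝 (Φ γ), ∀ t, δ t ∈ punctured f :=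
    (Path.eventually_mapsTo isCompact_univ (isOpen_punctured f) fun t _ => hγ' t).mono
      fun δ hδ t => hδ trivial
  obtain ⟨R, hR, hRr⟩ := Path.exists_continuousAt_of_continuousAt (y := z₀) (Φ γ)
    (fun _ p => retract f e p) rfl rfl (hN.mono fun δ hδ t =>
      ContinuousAt.comp (x := (t, δ t)) (f := Prod.snd)
        ((continuousOn_retract f e).continuousAt ((isOpen_punctured f).mem_nhds (hδ t)))
        continuous_snd.continuousAt)
  refine ⟨R ∘ Φ, hR.comp hΦ, ?_⟩
  filter_upwards [hΦh, hΦ.eventually (hN.and hRr)] with δ h1 h2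
  exact (homotopic_map_retract f e h2.1 h2.2).symm.trans h1

end AttachedSpace

/-! ### The main theorem -/

theorem PiOneQTop.mk_eq_of_homotopic {X : Type*} [TopologicalSpace X] {x : X} {γ δ : Path x x}
    (h : γ.Homotopic δ) : mk γ = mk δ :=
  congrArg FundamentalGroup.fromPath (Path.Homotopic.Quotient.eq.2 h)

theorem PiOneQTop.mk_surjective {X : Type*} [TopologicalSpace X] (x : X) :
    Function.Surjective (mk : Path x x → PiOneQTop X x) :=
  Path.Homotopic.Quotient.mk_surjective

theorem PiOneQTop.isQuotientMap_mk {X : Type*} [TopologicalSpace X] (x : X) :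
    IsQuotientMap (mk : Path x x → PiOneQTop X x) :=
  ⟨⟨rfl⟩, mk_surjective x⟩

theorem PiOneQTop.continuous_map {X Y : Type*} [TopologicalSpace X] [TopologicalSpace Y]
    (f : C(X, Y)) (x : X) : Continuous (map f x) := by
  rw [(isQuotientMap_mk x).continuous_iff]
  refine (isQuotientMap_mk (f x)).continuous.comp
    (f := fun γ : Path x x => γ.map f.continuous) ?_
  rw [← Path.continuous_uncurry_iff]
  exact f.continuous.comp Path.continuous_eval

/-- Openness is tested on loops. If the class of `γ` lies in `U`, then `Ψ γ` lies in the open set of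
loops whose image class is in `U`, hence so does `Ψ δ` for `δ` near `γ`, and its image class is that
of `δ`. -/
theorem AttachedSpace.isQuotientMap_map_incl {Z : Type*} [TopologicalSpace Z] (z₀ : Z) {n : ℕ}
    (hn : 2 ≤ n) {A : Type*} (e : CellBoundary n) (f : A → C(CellBoundary n, Z)) :
    IsQuotientMap (PiOneQTop.map (incl f) z₀) := by
  refine ⟨.of_isOpen_preimage_iff_isOpen fun U =>
    ⟨fun hU => ?_, fun hU => hU.preimage (PiOneQTop.continuous_map _ _)⟩, fun q => ?_⟩
  · rw [← (PiOneQTop.isQuotientMap_mk _).isOpen_preimage] at hU ⊢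
    refine isOpen_iff_mem_nhds.2 fun γ hγ => ?_
    obtain ⟨Ψ, hΨ, h⟩ := exists_continuousAt_lift f hn e γ
    have hmk {δ : Path (incl f z₀) (incl f z₀)}
        (hδ : ((Ψ δ).map (incl f).continuous).Homotopic δ) :
        PiOneQTop.map (incl f) z₀ (PiOneQTop.mk (Ψ δ)) = PiOneQTop.mk δ :=
      PiOneQTop.mk_eq_of_homotopic hδ
    have hγ' : PiOneQTop.map (incl f) z₀ (PiOneQTop.mk (Ψ γ)) ∈ U := by
      rwa [hmk h.self_of_nhds]
    filter_upwards [h, hΨ.eventually (hU.mem_nhds hγ')] with δ hδ hδU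
    change PiOneQTop.mk δ ∈ U
    rwa [← hmk hδ]
  · obtain ⟨γ, rfl⟩ := PiOneQTop.mk_surjective _ q
    obtain ⟨Ψ, -, h⟩ := exists_continuousAt_lift f hn e γ
    exact ⟨PiOneQTop.mk (Ψ γ), PiOneQTop.mk_eq_of_homotopic h.self_of_nhds⟩

theorem mainTheorem8 {Z : Type*} [TopologicalSpace Z] (z₀ : Z) (n : ℕ) (hn : 2 ≤ n)
    {A : Type*} (e : CellBoundary n) (f : A → C(CellBoundary n, Z)) (hf : ∀ a, f a e = z₀) :
    Topology.IsQuotientMap (PiOneQTop.map (AttachedSpace.incl f) z₀) ∧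
      Topology.IsQuotientMap (PiOneTau.map (AttachedSpace.incl f) z₀) :=
  ⟨AttachedSpace.isQuotientMap_map_incl z₀ hn e f,
    Tau.isQuotientMap_map _ (AttachedSpace.isQuotientMap_map_incl z₀ hn e f)⟩
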